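/- Let $G$ be a discrete group, let $\lambda$ be its left regular representation on $\ell^2(G)$, let $\mathrm{VN}(G)=\lambda(G)''$ be its group von Neumann algebra, and let $A(G)=\mathrm{VN}(G)_*$ be its Fourier algebra, with the operator space structure of a predual, regarded as an algebra of functions on $G$ through $\varphi\mapsto(x\mapsto\varphi(\lambda(x)))$. A function $f:G\to\mathbb C$ is a cb-multiplier of $A(G)$ if $fA(G)\subset A(G)$ and $M_f:A(G)\to A(G)$, $u\mapsto fu$, is completely bounded; write $\mathcal M_{\mathrm{cb}}(A(G))$ for the algebra of all cb-multipliers, with the norm $\|f\|=\|M_f\|_{\mathrm{cb}}$, and let $A_{\mathrm{cb}}(G)$ be the closure of $A(G)$ in $\mathcal M_{\mathrm{cb}}(A(G))$. The group $G$ is called weakly amenable if $A_{\mathrm{cb}}(G)$ has a bounded approximate identity. For $F\subset G$ put \[ I_{\mathrm{cb}}(F)=\{f\in A_{\mathrm{cb}}(G): f|_F\equiv 0\},\qquad J_{\mathrm{cb}}(F)=\overline{\{f\in A(G): \operatorname{supp} f \text{ is compact (i.e. finite) and } \operatorname{supp} f\cap F=\emptyset\}}^{\,\|\cdot\|_{A_{\mathrm{cb}}(G)}},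 \] and call $F$ a set of synthesis for $A_{\mathrm{cb}}(G)$ if $J_{\mathrm{cb}}(F)=I_{\mathrm{cb}}(F)$. If $G$ is discrete and weakly amenable, then every subset $F$ of $G$ is a set of synthesis for $A_{\mathrm{cb}}(G)$. -/

import Mathlib

open scoped ENNReal NNReal Topology

noncomputable section

universe u

namespace FourierCB

section Predual

variable {H : Type u} [NormedAddCommGroup H] [InnerProductSpace ℂ H] [CompleteSpace H]

/-- `φ` is a normal (that is, ultraweakly continuous) functional on `M`:
`φ T = ∑ₙ ⟨T ξₙ, ηₙ⟩` with `∑ ‖ξₙ‖² < ∞` and `∑ ‖ηₙ‖² < ∞`. Such a functional is automatically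
norm bounded. -/
def IsNormal (M : VonNeumannAlgebra H) (φ : M.toStarSubalgebra →ₗ[ℂ] ℂ) : Prop :=
  ∃ ξ η : ℕ → H, Summable (fun n => ‖ξ n‖ ^ 2) ∧ Summable (fun n => ‖η n‖ ^ 2) ∧
    ∀ T : M.toStarSubalgebra, HasSum (fun n => inner ℂ (η n) ((T : H →L[ℂ] H) (ξ n))) (φ T)

lemma summable_natSum {f : ℕ ⊕ ℕ → ℝ} (h₁ : Summable fun n => f (Sum.inl n))
    (h₂ : Summable fun n => f (Sum.inr n)) :
    Summable fun n => f (Equiv.natSumNatEquivNat.symm n) :=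
  (Equiv.summable_iff (f := f) Equiv.natSumNatEquivNat.symm).2 (h₁.hasSum.sum h₂.hasSum).summable

/-- The predual `M_*` of a von Neumann algebra `M`: the space of its normal functionals. -/
def predual (M : VonNeumannAlgebra H) : Submodule ℂ (M.toStarSubalgebra →ₗ[ℂ] ℂ) where
  carrier := {φ | IsNormal M φ}
  zero_mem' := ⟨0, 0, by simp, by simp, fun T => by simp⟩
  add_mem' := by
    rintro φ ψ ⟨ξ, η, h1, h2, h3⟩ ⟨ξ', η', h1', h2', h3'⟩
    refine ⟨fun n => Sum.elim ξ ξ' (Equiv.natSumNatEquivNat.symm n),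
      fun n => Sum.elim η η' (Equiv.natSumNatEquivNat.symm n), ?_, ?_, fun T => ?_⟩
    · exact summable_natSum (f := fun s => ‖Sum.elim ξ ξ' s‖ ^ 2) h1 h1'
    · exact summable_natSum (f := fun s => ‖Sum.elim η η' s‖ ^ 2) h2 h2'
    · refine (Equiv.hasSum_iff (f := fun s : ℕ ⊕ ℕ =>
        inner ℂ (Sum.elim η η' s) ((T : H →L[ℂ] H) (Sum.elim ξ ξ' s)))
        Equiv.natSumNatEquivNat.symm).2 ?_
      exact HasSum.sum (h3 T) (h3' T)
  smul_mem' := by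
    rintro c φ ⟨ξ, η, h1, h2, h3⟩
    refine ⟨fun n => c • ξ n, η, ?_, h2, fun T => ?_⟩
    · simpa [norm_smul, mul_pow] using h1.mul_left (‖c‖ ^ 2)
    · simpa [inner_smul_right] using (h3 T).mul_left c

/-- The operator on the Hilbert space `H ⊕ ⋯ ⊕ H` (`m` summands) given by an `m × m` matrix of
operators on `H`. Its operator norm is the norm of `M_m(B(H))`. -/
def blockOp {m : ℕ} (T : Matrix (Fin m) (Fin m) (H →L[ℂ] H)) :
    PiLp 2 (fun _ : Fin m => H) →L[ℂ] PiLp 2 (fun _ : Fin m => H) :=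
  ((PiLp.continuousLinearEquiv 2 ℂ (fun _ : Fin m => H)).symm :
      (∀ _ : Fin m, H) →L[ℂ] PiLp 2 (fun _ : Fin m => H)) ∘L
    ContinuousLinearMap.pi fun k => ∑ l, T k l ∘L PiLp.proj 2 (fun _ : Fin m => H) l

/-- The norm of `M_n(M_*)` in the canonical operator space structure of the predual: an `n × n`
matrix `φ` of normal functionals has the completely bounded norm of the map
`M → M_n(ℂ)`, `T ↦ [φ i j T]`, i.e. the supremum over `m` and over the unit ball of `M_m(M)` of the
operator norm of the `nm × nm` matrix `[φ i j (T k l)]`. -/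
def predualMatrixNorm (M : VonNeumannAlgebra H) {n : ℕ}
    (φ : Matrix (Fin n) (Fin n) (predual M)) : ℝ≥0∞ :=
  ⨆ (m : ℕ) (T : Matrix (Fin m) (Fin m) M.toStarSubalgebra)
    (_ : ‖blockOp (T.map fun t => (t : H →L[ℂ] H))‖ ≤ 1),
    ‖Matrix.toEuclideanCLM (𝕜 := ℂ) (n := Fin n × Fin m)
      (Matrix.of fun p q => (φ p.1 q.1 : M.toStarSubalgebra →ₗ[ℂ] ℂ) (T p.2 q.2))‖ₑ

/-- The completely bounded norm (possibly `∞`) of a linear map `S : M_* → M_*`: the supremum over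
`n` of the norms of the amplifications `M_n(M_*) → M_n(M_*)`. -/
def cbNorm (M : VonNeumannAlgebra H) (S : predual M →ₗ[ℂ] predual M) : ℝ≥0∞ :=
  ⨆ (n : ℕ) (φ : Matrix (Fin n) (Fin n) (predual M)) (_ : predualMatrixNorm M φ ≤ 1),
    predualMatrixNorm M (φ.map S)

end Predual

section Group

variable (G : Type u) [Group G]

/-- The Hilbert space `ℓ²(G)`. -/
abbrev ell2 : Type u := lp (fun _ : G => ℂ) 2

variable {G}

/-- The left regular representation: `(λ(x) ξ)(t) = ξ(x⁻¹ t)`. -/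
def leftReg (x : G) : ell2 G →L[ℂ] ell2 G :=
  LinearMap.mkContinuous
    { toFun := fun ξ => ⟨fun t => ξ (x⁻¹ * t), by
        have h := (memℓp_gen_iff (p := 2) (by norm_num)).1 (lp.memℓp ξ)
        exact (memℓp_gen_iff (p := 2) (by norm_num)).2
          (h.comp_injective (mul_right_injective x⁻¹))⟩
      map_add' := fun ξ η => by ext t; rfl
      map_smul' := fun c ξ => by ext t; rfl } 1 (fun ξ => by
        rw [one_mul, lp.norm_eq_tsum_rpow (by norm_num), lp.norm_eq_tsum_rpow (by norm_num)]
        exact le_of_eq (congrArg (· ^ (1 / (2 : ℝ≥0∞).toReal))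
          ((Equiv.mulLeft x⁻¹).tsum_eq fun t => ‖ξ t‖ ^ (2 : ℝ≥0∞).toReal)))

@[simp] lemma leftReg_apply (x : G) (ξ : ell2 G) (t : G) : leftReg x ξ t = ξ (x⁻¹ * t) := rfl

variable (G) in
/-- The group von Neumann algebra `VN(G)`: the von Neumann algebra on `ℓ²(G)` generated by the
left regular representation, i.e. the double commutant of `λ(G)`
(`StarSubalgebra.centralizer` is the commutant of the star-closure of a set, and `λ(G)` is closed
under adjoints). -/
def groupVN : VonNeumannAlgebra (ell2 G) where
  toStarSubalgebra := StarSubalgebra.centralizer ℂ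
    (StarSubalgebra.centralizer ℂ (Set.range (leftReg (G := G))) : Set (ell2 G →L[ℂ] ell2 G))
  centralizer_centralizer' := by
    change Set.centralizer (Set.centralizer
      ((StarSubalgebra.centralizer ℂ (StarSubalgebra.centralizer ℂ
        (Set.range (leftReg (G := G))) : Set (ell2 G →L[ℂ] ell2 G)) :
          StarSubalgebra ℂ (ell2 G →L[ℂ] ell2 G)) : Set (ell2 G →L[ℂ] ell2 G))) = _
    rw [StarSubalgebra.coe_centralizer_centralizer, Set.centralizer_centralizer_centralizer]
    exact (StarSubalgebra.coe_centralizer_centralizer ℂ _).symm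

/-- `λ(x)` as an element of `VN(G)`. -/
def lambda (x : G) : (groupVN G).toStarSubalgebra :=
  ⟨leftReg x, by
    change leftReg x ∈ ((StarSubalgebra.centralizer ℂ (StarSubalgebra.centralizer ℂ
        (Set.range (leftReg (G := G))) : Set (ell2 G →L[ℂ] ell2 G)) :
          StarSubalgebra ℂ (ell2 G →L[ℂ] ell2 G)) : Set (ell2 G →L[ℂ] ell2 G))
    rw [StarSubalgebra.coe_centralizer_centralizer]
    exact Set.subset_centralizer_centralizer (Or.inl ⟨x, rfl⟩)⟩

/-- The function on `G` that corresponds to an element of `VN(G)_*`: `x ↦ φ(λ(x))`. -/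
def toFun (φ : predual (groupVN G)) (x : G) : ℂ :=
  (φ : (groupVN G).toStarSubalgebra →ₗ[ℂ] ℂ) (lambda x)

variable (G) in
/-- The Fourier algebra `A(G) = VN(G)_*`, as a set of functions on `G`. -/
def fourierAlgebra : Set (G → ℂ) := Set.range (toFun (G := G))

/-- `S` is the operator `M_f : A(G) → A(G)` of multiplication with the function `f`, where `A(G)`
is identified with `VN(G)_*`. -/
def IsMultiplication (f : G → ℂ) (S : predual (groupVN G) →ₗ[ℂ] predual (groupVN G)) : Prop :=
  ∀ φ, toFun (S φ) = f * toFun φ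

/-- The cb-multiplier norm of `f`, i.e. the completely bounded norm of `M_f`. The infimum ranges
over at most one `S`, because a normal functional on `VN(G)` is determined by its values on `λ(G)`;
it is `∞` if `f` is not a multiplier of `A(G)`. -/
def multNorm (f : G → ℂ) : ℝ≥0∞ :=
  ⨅ (S : predual (groupVN G) →ₗ[ℂ] predual (groupVN G)) (_ : IsMultiplication f S),
    cbNorm (groupVN G) S

variable (G) in
/-- The completely bounded multipliers `M_cb(A(G))` of the Fourier algebra. -/
def cbMultipliers : Set (G → ℂ) := {f | multNorm f < ∞}

/-- The closure in `M_cb(A(G))` of a set of functions, with respect to the cb-multiplier norm. -/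
def cbClosure (E : Set (G → ℂ)) : Set (G → ℂ) :=
  {f | f ∈ cbMultipliers G ∧ ∀ ε : ℝ≥0∞, 0 < ε → ∃ g ∈ E, multNorm (f - g) < ε}

variable (G) in
/-- `A_cb(G)`: the closure of `A(G)` in `M_cb(A(G))`. -/
def Acb : Set (G → ℂ) := cbClosure (fourierAlgebra G)

variable (G) in
/-- `G` is weakly amenable: `A_cb(G)` has a bounded approximate identity. -/
def IsWeaklyAmenable : Prop :=
  ∃ (ι : Type u) (_ : Preorder ι) (_ : IsDirectedOrder ι) (_ : Nonempty ι)
    (e : ι → G → ℂ) (C : ℝ≥0),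
    (∀ i, e i ∈ Acb G ∧ multNorm (e i) ≤ C) ∧
    ∀ f ∈ Acb G, Filter.Tendsto (fun i => multNorm (f * e i - f)) Filter.atTop (𝓝 0)

/-- `I_cb(F)`: the functions in `A_cb(G)` that vanish on `F`. -/
def Icb (F : Set G) : Set (G → ℂ) := {f | f ∈ Acb G ∧ ∀ x ∈ F, f x = 0}

/-- `J_cb(F)`: the closure in the norm of `A_cb(G)` of the functions in `A(G)` with compact support
disjoint from `F`. As `G` is discrete, the support of `f` is `{x | f x ≠ 0}`, and it is compact if
and only if it is finite. -/
def Jcb (F : Set G) : Set (G → ℂ) :=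
  cbClosure {f | f ∈ fourierAlgebra G ∧ (Function.support f).Finite ∧
    Disjoint (Function.support f) F}

/-- `F` is a set of synthesis for `A_cb(G)`. -/
def IsSynthesisSet (F : Set G) : Prop := Jcb F = Icb F

end Group

end FourierCB

end

/-! The inclusion of `Jcb` in `Icb` holds because point evaluations are bounded by the multiplier
norm (`enorm_apply_le_multNorm`). For the converse, let `f` vanish on `F`. Weak amenability makes `f
* e` close to `f` for some `e` in `Acb G`, and `e` is close to a finitely supported `v`. Then `f *
v` is close to `f`, has finite support off `F`, and lies in `A(G)` because every point mass does.

What remains is the density of finitely supported functions in `Acb G`. By normality, an element of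
`A(G)` is a coefficient `x ↦ ⟨(1 ⊗ λ(x)) ξ, η⟩` (`exists_eq_coefficient`), and truncating both
vectors gives finite support. The error is controlled by `multNorm_coefficient_le`: a coefficient
has multiplier norm at most `‖η‖ * ‖ξ‖`. This follows from `Column.Represents.multNorm_le`: if `k (s
* t⁻¹)` is the inner product of columns `a` at `t` and `b` at `s`, then Schur multiplication by this
kernel is a completely bounded normal map of `VN(G)` into itself, and its preadjoint is `M_k`. -/

noncomputable section

universe v

namespace FourierCB

/-! ### Square-summable series -/

section Series

variable {ι : Type*}

/-- The Cauchy–Schwarz inequality for series of complex numbers. -/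
theorem summable_norm_and_norm_tsum_le {f : ι → ℂ} {p q : ι → ℝ} {A B c : ℝ}
    (hp : ∀ i, 0 ≤ p i) (hq : ∀ i, 0 ≤ q i) (hA : 0 ≤ A) (hB : 0 ≤ B) (hc : 0 ≤ c)
    (hpA : HasSum (fun i => p i ^ 2) (A ^ 2)) (hqB : HasSum (fun i => q i ^ 2) (B ^ 2))
    (hf : ∀ i, ‖f i‖ ≤ c * (p i * q i)) :
    (Summable fun i => ‖f i‖) ∧ ‖∑' i, f i‖ ≤ c * (A * B) := by
  obtain ⟨C, -, hC, hsum⟩ := Real.inner_le_Lp_mul_Lq_hasSum_of_nonneg (f := p) (g := q)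
    Real.HolderConjugate.two_two hA hB hp hq (by simpa using hpA) (by simpa using hqB)
  have hs : Summable fun i => ‖f i‖ :=
    Summable.of_nonneg_of_le (fun i => norm_nonneg _) hf (hsum.summable.mul_left c)
  refine ⟨hs, (norm_tsum_le_tsum_norm hs).trans ?_⟩
  refine (hs.tsum_le_tsum hf (hsum.summable.mul_left c)).trans ?_
  rw [(hsum.mul_left c).tsum_eq]
  gcongr

/-- In `ℝ≥0∞` double sums can be interchanged with no summability to check. -/
theorem hasSum_sq_iff_tsum_enorm_sq {E : Type*} [SeminormedAddCommGroup E] (f : ι → E) (A : ℝ) :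
    HasSum (fun i => ‖f i‖ ^ 2) (A ^ 2) ↔ ∑' i, ‖f i‖ₑ ^ 2 = ‖A‖ₑ ^ 2 := by
  have h1 : (fun i => ‖f i‖ ^ 2) = fun i => ((‖f i‖₊ ^ 2 : ℝ≥0) : ℝ) := by ext; simp
  have h2 : A ^ 2 = ((‖A‖₊ ^ 2 : ℝ≥0) : ℝ) := by simp
  have h3 : ∀ i, ‖f i‖ₑ ^ 2 = ((‖f i‖₊ ^ 2 : ℝ≥0) : ℝ≥0∞) := fun i => by
    rw [ENNReal.coe_pow]; rfl
  have h4 : ‖A‖ₑ ^ 2 = ((‖A‖₊ ^ 2 : ℝ≥0) : ℝ≥0∞) := by rw [ENNReal.coe_pow]; rfl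
  rw [h1, h2, NNReal.hasSum_coe, ← ENNReal.hasSum_coe, h4, funext fun i => (h3 i).symm]
  exact ⟨fun h => h.tsum_eq, fun h => h ▸ ENNReal.summable.hasSum⟩

end Series

/-! ### Schur multipliers on `B(ℓ²(G))` -/

section Ell2

variable {G : Type u} {ι : Type v}

theorem hasSum_norm_sq (α : ell2 G) : HasSum (fun t => ‖α t‖ ^ 2) (‖α‖ ^ 2) := by
  simpa using lp.hasSum_norm (p := 2) (by norm_num) α

theorem memℓp_two_of_summable {f : G → ℂ} (hf : Summable fun t => ‖f t‖ ^ 2) : Memℓp f 2 :=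
  (memℓp_gen_iff (p := 2) (by norm_num)).2 (by simpa using hf)

/-- A map `t ↦ (a i t)ᵢ` from `G` to `ℓ²(ι)` of constant norm. -/
structure Column (ι : Type v) (G : Type u) where
  /-- the coordinates -/
  coord : ι → G → ℂ
  /-- the common norm of the values -/
  norm : ℝ
  norm_nonneg : 0 ≤ norm
  hasSum : ∀ t, HasSum (fun i => ‖coord i t‖ ^ 2) (norm ^ 2)

namespace Column

theorem norm_coord_le (a : Column ι G) (i : ι) (t : G) : ‖a.coord i t‖ ≤ a.norm :=
  le_of_sq_le_sq ((le_hasSum (a.hasSum t) i fun _ _ => sq_nonneg _)) a.norm_nonneg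

/-- Pointwise multiplication with the `i`-th coordinate of a column. -/
def diag (a : Column ι G) (i : ι) : ell2 G →ₗ[ℂ] ell2 G where
  toFun α := ⟨fun t => a.coord i t * α t, memℓp_two_of_summable <|
    Summable.of_nonneg_of_le (fun t => sq_nonneg _) (fun t => by
      rw [norm_mul, mul_pow]
      have := a.norm_coord_le i t
      gcongr) ((hasSum_norm_sq α).summable.mul_left (a.norm ^ 2))⟩
  map_add' α β := by ext t; exact mul_add _ _ _
  map_smul' c α := by ext t; exact mul_left_comm _ _ _

@[simp] theorem diag_apply (a : Column ι G) (i : ι) (α : ell2 G) (t : G) :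
    a.diag i α t = a.coord i t * α t := rfl

/-- Tonelli: summing over `i` first yields the constant `a.norm ^ 2` at each `t`. Thus `α ↦ (Dᵢ α)ᵢ`
is `a.norm` times an isometry. -/
theorem hasSum_norm_diag_sq (a : Column ι G) (α : ell2 G) :
    HasSum (fun i => ‖a.diag i α‖ ^ 2) ((a.norm * ‖α‖) ^ 2) := by
  have h (β : ell2 G) := (hasSum_sq_iff_tsum_enorm_sq (fun t => β t) ‖β‖).1 (hasSum_norm_sq β)
  rw [hasSum_sq_iff_tsum_enorm_sq]
  simp only [enorm_norm] at h
  simp only [← h, diag_apply, enorm_mul, mul_pow, enorm_norm]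
  rw [ENNReal.tsum_comm, ← ENNReal.tsum_mul_left]
  refine tsum_congr fun t => ?_
  rw [ENNReal.tsum_mul_right, (hasSum_sq_iff_tsum_enorm_sq _ _).1 (a.hasSum t)]

theorem diag_single [DecidableEq G] (a : Column ι G) (i : ι) (t : G) :
    a.diag i (lp.single 2 t (1 : ℂ)) = a.coord i t • lp.single 2 t (1 : ℂ) := by
  ext s
  by_cases h : s = t
  · subst h; simp
  · simp [h]

variable (b a : Column ι G)

theorem summable_inner_diag (T : ell2 G →L[ℂ] ell2 G) (β α : ell2 G) :
    (Summable fun i => inner ℂ (b.diag i β) (T (a.diag i α))) ∧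
    ‖∑' i, inner ℂ (b.diag i β) (T (a.diag i α))‖ ≤ (‖T‖ * (b.norm * a.norm)) * ‖β‖ * ‖α‖ := by
  have h := summable_norm_and_norm_tsum_le (fun i => _root_.norm_nonneg (b.diag i β))
    (fun i => _root_.norm_nonneg (a.diag i α)) (mul_nonneg b.norm_nonneg (_root_.norm_nonneg β))
    (mul_nonneg a.norm_nonneg (_root_.norm_nonneg α)) (_root_.norm_nonneg T)
    (b.hasSum_norm_diag_sq β) (a.hasSum_norm_diag_sq α)
    (f := fun i => inner ℂ (b.diag i β) (T (a.diag i α))) fun i => by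
      refine (norm_inner_le_norm _ _).trans ?_
      calc ‖b.diag i β‖ * ‖T (a.diag i α)‖ ≤ ‖b.diag i β‖ * (‖T‖ * ‖a.diag i α‖) := by
            gcongr; exact T.le_opNorm _
        _ = _ := by ring
  exact ⟨h.1.of_norm, h.2.trans (le_of_eq (by ring))⟩

/-- The operator `∑ᵢ Dᵢ(b)* T Dᵢ(a)`, where `Dᵢ` is multiplication with the `i`-th coordinate. -/
def schurOp (T : ell2 G →L[ℂ] ell2 G) : ell2 G →L[ℂ] ell2 G :=
  -- The operator of a bounded form represents it through its first argument; the adjoint moves it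
  -- to the second.
  ContinuousLinearMap.adjoint <| InnerProductSpace.continuousLinearMapOfBilin (𝕜 := ℂ) <|
    LinearMap.mkContinuous₂
      (LinearMap.mk₂'ₛₗ (starRingEnd ℂ) (RingHom.id ℂ)
        (fun β α => ∑' i, inner ℂ (b.diag i β) (T (a.diag i α)))
        (fun β β' α => by
          simp only [map_add, inner_add_left]
          exact (b.summable_inner_diag a T β α).1.tsum_add (b.summable_inner_diag a T β' α).1)
        (fun c β α => by
          simp only [map_smul, inner_smul_left, smul_eq_mul]
          exact tsum_mul_left)
        (fun β α α' => by
          simp only [map_add, inner_add_right]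
          exact (b.summable_inner_diag a T β α).1.tsum_add (b.summable_inner_diag a T β α').1)
        (fun c β α => by
          simp only [map_smul, inner_smul_right, smul_eq_mul]
          exact tsum_mul_left))
      (‖T‖ * (b.norm * a.norm)) fun β α => (b.summable_inner_diag a T β α).2

theorem hasSum_inner_schurOp (T : ell2 G →L[ℂ] ell2 G) (β α : ell2 G) :
    HasSum (fun i => inner ℂ (b.diag i β) (T (a.diag i α))) (inner ℂ β (schurOp b a T α)) := by
  rw [schurOp, ContinuousLinearMap.adjoint_inner_right,
    InnerProductSpace.continuousLinearMapOfBilin_apply]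
  exact (b.summable_inner_diag a T β α).1.hasSum

theorem schurOp_add (T T' : ell2 G →L[ℂ] ell2 G) :
    schurOp b a (T + T') = schurOp b a T + schurOp b a T' := by
  refine ContinuousLinearMap.ext fun α => ext_inner_left ℂ fun β => ?_
  refine (hasSum_inner_schurOp b a (T + T') β α).unique ?_
  simpa [inner_add_right] using
    (hasSum_inner_schurOp b a T β α).add (hasSum_inner_schurOp b a T' β α)

theorem schurOp_smul (c : ℂ) (T : ell2 G →L[ℂ] ell2 G) :
    schurOp b a (c • T) = c • schurOp b a T := by
  refine ContinuousLinearMap.ext fun α => ext_inner_left ℂ fun β => ?_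
  refine (hasSum_inner_schurOp b a (c • T) β α).unique ?_
  simpa [inner_smul_right] using (hasSum_inner_schurOp b a T β α).mul_left c

/-- The matrix of `schurOp b a T` is the Schur product of the matrix of `T` with the Gram matrix
of `a` and `b`. -/
theorem hasSum_inner_schurOp_single [DecidableEq G] (T : ell2 G →L[ℂ] ell2 G) (s t : G) :
    HasSum (fun i => (starRingEnd ℂ (b.coord i s) * a.coord i t) *
      T (lp.single 2 t (1 : ℂ)) s) (schurOp b a T (lp.single 2 t (1 : ℂ)) s) := by
  have h := hasSum_inner_schurOp b a T (lp.single 2 s (1 : ℂ)) (lp.single 2 t (1 : ℂ))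
  simp only [diag_single, map_smul, inner_smul_left, inner_smul_right,
    lp.inner_single_left (𝕜 := ℂ) (G := fun _ : G => ℂ)] at h
  simpa [mul_assoc, mul_left_comm] using h

/-- Schur multiplication is completely bounded. -/
theorem norm_blockOp_schurOp_le {m : ℕ} (T : Matrix (Fin m) (Fin m) (ell2 G →L[ℂ] ell2 G)) :
    ‖blockOp (T.map (schurOp b a))‖ ≤ b.norm * a.norm * ‖blockOp T‖ := by
  have inner_blockOp (T : Matrix (Fin m) (Fin m) (ell2 G →L[ℂ] ell2 G))
      (β α : PiLp 2 fun _ : Fin m => ell2 G) :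
      inner ℂ β (blockOp T α) = ∑ k, ∑ l, inner ℂ (β k) (T k l (α l)) := by
    simp [blockOp, PiLp.inner_apply, inner_sum]
  have hD (c : Column ι G) (γ : PiLp 2 fun _ : Fin m => ell2 G) :
      HasSum (fun i => ‖(WithLp.toLp 2 fun k => c.diag i (γ k) : PiLp 2 fun _ : Fin m => ell2 G)‖ ^ 2)
        ((c.norm * ‖γ‖) ^ 2) := by
    simp only [PiLp.norm_sq_eq_of_L2, mul_pow, Finset.mul_sum]
    exact hasSum_sum fun k _ => by simpa [mul_pow] using c.hasSum_norm_diag_sq (γ k)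
  have hM : 0 ≤ b.norm * a.norm * ‖blockOp T‖ :=
    mul_nonneg (mul_nonneg b.norm_nonneg a.norm_nonneg) (_root_.norm_nonneg _)
  refine ContinuousLinearMap.opNorm_le_bound _ hM fun α => ?_
  -- The image is tested against itself: Cauchy–Schwarz over `i` bounds `‖β‖ ^ 2` by the desired
  -- constant times `‖β‖ * ‖α‖`, and one factor `‖β‖` cancels.
  set β := blockOp (T.map (schurOp b a)) α with hβ
  have key : HasSum (fun i => inner ℂ
      (WithLp.toLp 2 fun k => b.diag i (β k) : PiLp 2 fun _ : Fin m => ell2 G)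
      (blockOp T (WithLp.toLp 2 fun k => a.diag i (α k)))) (inner ℂ β β) := by
    rw [show inner ℂ β β = inner ℂ β (blockOp (T.map (schurOp b a)) α) from rfl]
    simp only [inner_blockOp]
    exact hasSum_sum fun k _ => hasSum_sum fun l _ => b.hasSum_inner_schurOp a (T k l) (β k) (α l)
  have h := (summable_norm_and_norm_tsum_le (fun i => _root_.norm_nonneg _)
    (fun i => _root_.norm_nonneg _) (mul_nonneg b.norm_nonneg (_root_.norm_nonneg β))
    (mul_nonneg a.norm_nonneg (_root_.norm_nonneg α)) (_root_.norm_nonneg (blockOp T))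
    (hD b β) (hD a α)
    (f := fun i => inner ℂ
      (WithLp.toLp 2 fun k => b.diag i (β k) : PiLp 2 fun _ : Fin m => ell2 G)
      (blockOp T (WithLp.toLp 2 fun k => a.diag i (α k)))) fun i => by
      refine (norm_inner_le_norm _ _).trans ?_
      rw [mul_left_comm]
      gcongr
      exact (blockOp T).le_opNorm _).2
  rw [key.tsum_eq, inner_self_eq_norm_sq_to_K] at h
  rcases eq_or_ne ‖β‖ 0 with h0 | h0
  · rw [h0]; exact mul_nonneg hM (_root_.norm_nonneg _)
  · have hpos : 0 < ‖β‖ := lt_of_le_of_ne (_root_.norm_nonneg _) (Ne.symm h0)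
    refine le_of_mul_le_mul_left ?_ hpos
    have h' : ‖β‖ ^ 2 ≤ ‖blockOp T‖ * (b.norm * ‖β‖ * (a.norm * ‖α‖)) := by simpa using h
    linarith [h']

end Column

end Ell2

/-! ### Reindexing normal functionals -/

section Normal

variable {H : Type u} [NormedAddCommGroup H] [InnerProductSpace ℂ H] [CompleteSpace H]

/-- The index set in the definition of a normal functional may be arbitrary. -/
theorem isNormal_of_hasSum {ι : Type v} (M : VonNeumannAlgebra H) (φ : M.toStarSubalgebra →ₗ[ℂ] ℂ)
    (ξ η : ι → H) (hξ : Summable fun i => ‖ξ i‖ ^ 2) (hη : Summable fun i => ‖η i‖ ^ 2)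
    (h : ∀ T : M.toStarSubalgebra, HasSum (fun i => inner ℂ (η i) ((T : H →L[ℂ] H) (ξ i))) (φ T)) :
    IsNormal M φ := by
  -- Square summability leaves only countably many nonzero `ξ i`, and the other indices contribute
  -- nothing. This countable set is embedded in `ℕ` and the vectors are extended by zero.
  set s : Set ι := Function.support fun i => ‖ξ i‖ ^ 2 with hs
  have hsc : s.Countable := hξ.countable_support
  obtain ⟨e, he⟩ := hsc.to_subtype.exists_injective_nat
  have key {E : Type u} [NormedAddCommGroup E] (ζ : ι → E) (h : Summable fun i => ‖ζ i‖ ^ 2) :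
      Summable fun n => ‖Function.extend e (fun i : s => ζ i) 0 n‖ ^ 2 := by
    have : (fun n => ‖Function.extend e (fun i : s => ζ i) 0 n‖ ^ 2) =
        Function.extend e (fun i : s => ‖ζ i‖ ^ 2) 0 := by
      ext n
      by_cases hn : ∃ i, e i = n
      · obtain ⟨i, rfl⟩ := hn
        simp [he.extend_apply]
      · simp [Function.extend_apply' _ _ _ hn]
    rw [this, summable_extend_zero he]
    exact h.subtype s
  refine ⟨_, _, key ξ hξ, key η hη, fun T => ?_⟩
  have : (fun n => inner ℂ (Function.extend e (fun i : s => η i) 0 n)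
        ((T : H →L[ℂ] H) (Function.extend e (fun i : s => ξ i) 0 n))) =
      Function.extend e (fun i : s => inner ℂ (η i) ((T : H →L[ℂ] H) (ξ i))) 0 := by
    ext n
    by_cases hn : ∃ i, e i = n
    · obtain ⟨i, rfl⟩ := hn
      simp [he.extend_apply]
    · simp [Function.extend_apply' _ _ _ hn]
  rw [this, hasSum_extend_zero he]
  refine (hasSum_subtype_iff_of_support_subset (f := fun i => inner ℂ (η i)
    ((T : H →L[ℂ] H) (ξ i))) fun i hi => ?_).2 (h T)
  simp only [hs, Function.mem_support] at hi ⊢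
  intro h0
  apply hi
  have : ξ i = 0 := by simpa using h0
  simp [this]

end Normal

/-! ### Matrix entries of operators on `ℓ²(G)` -/

section Matrix

variable {G : Type u} [DecidableEq G]

theorem ext_single {S T : ell2 G →L[ℂ] ell2 G}
    (h : ∀ s t, S (lp.single 2 t (1 : ℂ)) s = T (lp.single 2 t (1 : ℂ)) s) : S = T := by
  refine ContinuousLinearMap.ext fun α => ?_
  have hα := lp.hasSum_single (p := 2) (by norm_num) α
  refine (hα.mapL S).unique ?_
  convert hα.mapL T using 2 with t
  have : lp.single 2 t (α t) = α t • (lp.single 2 t (1 : ℂ) : ell2 G) := by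
    rw [← lp.single_smul]; simp
  rw [this, map_smul, map_smul]
  congr 1
  ext s
  exact h s t

theorem mul_single_apply (S T : ell2 G →L[ℂ] ell2 G) (s t : G) :
    HasSum (fun r => S (lp.single 2 r (1 : ℂ)) s * T (lp.single 2 t (1 : ℂ)) r)
      ((S * T) (lp.single 2 t (1 : ℂ)) s) := by
  have h := lp.hasSum_inner (𝕜 := ℂ) (ContinuousLinearMap.adjoint S (lp.single 2 s (1 : ℂ)))
    (T (lp.single 2 t (1 : ℂ)))
  rw [ContinuousLinearMap.adjoint_inner_left, lp.inner_single_left] at h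
  have h1 (r : G) : ContinuousLinearMap.adjoint S (lp.single 2 s (1 : ℂ)) r =
      starRingEnd ℂ (S (lp.single 2 r (1 : ℂ)) s) := by
    have := ContinuousLinearMap.adjoint_inner_right S (lp.single 2 r (1 : ℂ)) (lp.single 2 s (1 : ℂ))
    rw [lp.inner_single_left, lp.inner_single_right] at this
    simpa using this
  simpa [h1, mul_comm] using h

end Matrix

/-! ### `VN(G)` described by matrix entries -/

section GroupVN

variable {G : Type u} [Group G]

/-- The right regular representation: `(ρ(x) ξ)(t) = ξ(t x)`. -/
def rightReg (x : G) : ell2 G →L[ℂ] ell2 G :=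
  LinearMap.mkContinuous
    { toFun := fun ξ => ⟨fun t => ξ (t * x), memℓp_two_of_summable
        ((hasSum_norm_sq ξ).summable.comp_injective (mul_left_injective x))⟩
      map_add' := fun ξ η => by ext t; rfl
      map_smul' := fun c ξ => by ext t; rfl } 1 (fun ξ => by
        rw [one_mul]
        refine le_of_sq_le_sq (le_of_eq ?_) (norm_nonneg _)
        exact (hasSum_norm_sq _).unique ((Equiv.mulRight x).hasSum_iff.2 (hasSum_norm_sq ξ)))

@[simp] theorem rightReg_apply (x : G) (ξ : ell2 G) (t : G) : rightReg x ξ t = ξ (t * x) := rfl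

theorem star_leftReg (x : G) : star (leftReg x) = leftReg x⁻¹ := by
  rw [ContinuousLinearMap.star_eq_adjoint, eq_comm, ContinuousLinearMap.eq_adjoint_iff]
  intro α β
  refine (lp.hasSum_inner (𝕜 := ℂ) (leftReg x⁻¹ α) β).unique ?_
  have := lp.hasSum_inner (𝕜 := ℂ) α (leftReg x β)
  rw [← (Equiv.mulLeft x).hasSum_iff] at this
  simpa [Function.comp_def] using this

theorem mem_centralizer_leftReg_iff {X : ell2 G →L[ℂ] ell2 G} :
    X ∈ StarSubalgebra.centralizer ℂ (Set.range (leftReg (G := G))) ↔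
      ∀ x : G, leftReg x * X = X * leftReg x := by
  rw [StarSubalgebra.mem_centralizer_iff]
  simp only [Set.forall_mem_range, star_leftReg]
  exact ⟨fun h x => (h x).1, fun h x => ⟨h x, h x⁻¹⟩⟩

variable [DecidableEq G]

theorem leftReg_single (x t : G) :
    leftReg x (lp.single 2 t (1 : ℂ)) = lp.single 2 (x * t) (1 : ℂ) := by
  ext s
  simp [Pi.single_apply, inv_mul_eq_iff_eq_mul]

theorem rightReg_single (x t : G) :
    rightReg x (lp.single 2 t (1 : ℂ)) = lp.single 2 (t * x⁻¹) (1 : ℂ) := by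
  ext s
  simp [Pi.single_apply, eq_mul_inv_iff_mul_eq]

/-- Right translations commute with `λ(G)`, so they commute with `VN(G)`. Conversely, operators in
the commutant of `λ(G)` have left-invariant matrices, and these commute with right-invariant ones by
a change of variable in the matrix product. -/
theorem mem_groupVN_iff {T : ell2 G →L[ℂ] ell2 G} :
    T ∈ (groupVN G).toStarSubalgebra ↔
      ∀ s t r : G, T (lp.single 2 (t * r) (1 : ℂ)) (s * r) = T (lp.single 2 t (1 : ℂ)) s := by
  change T ∈ StarSubalgebra.centralizer ℂ
    (StarSubalgebra.centralizer ℂ (Set.range (leftReg (G := G))) : Set (ell2 G →L[ℂ] ell2 G)) ↔ _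
  constructor
  · intro h s t r
    have hr : rightReg r⁻¹ ∈ StarSubalgebra.centralizer ℂ (Set.range (leftReg (G := G))) :=
      mem_centralizer_leftReg_iff.2 fun x => by
        refine ContinuousLinearMap.ext fun α => ?_
        ext t
        simp [mul_assoc]
    have := congrArg (fun S : ell2 G →L[ℂ] ell2 G => S (lp.single 2 t (1 : ℂ)) (s * r))
      ((StarSubalgebra.mem_centralizer_iff ℂ).1 h _ hr).1
    simpa [rightReg_single] using this.symm
  · intro h
    have main : ∀ X ∈ StarSubalgebra.centralizer ℂ (Set.range (leftReg (G := G))),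
        X * T = T * X := by
      intro X hX
      rw [mem_centralizer_leftReg_iff] at hX
      have hX' (x s t : G) : X (lp.single 2 (x * t) (1 : ℂ)) (x * s) =
          X (lp.single 2 t (1 : ℂ)) s := by
        have := congrArg (fun S : ell2 G →L[ℂ] ell2 G => S (lp.single 2 t (1 : ℂ)) (x * s)) (hX x)
        simpa [leftReg_single] using this.symm
      refine ext_single fun s t => (mul_single_apply X T s t).unique ?_
      -- The substitution `r ↦ s * r⁻¹ * t` matches the terms of `X * T` with those of `T * X` at
      -- entry `(s, t)`.
      let e : G ≃ G := ((Equiv.inv G).trans (Equiv.mulLeft s)).trans (Equiv.mulRight t)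
      rw [← e.hasSum_iff]
      convert mul_single_apply T X s t using 2 with r
      have h2 := h s r (r⁻¹ * t)
      have h3 := hX' (s * r⁻¹) r t
      simp only [Function.comp_apply, e, Equiv.trans_apply, Equiv.inv_apply, Equiv.coe_mulLeft,
        Equiv.coe_mulRight]
      rw [← h2, ← h3, mul_comm]
      simp [mul_assoc]
    refine (StarSubalgebra.mem_centralizer_iff ℂ).2 fun X hX => ⟨main X hX, ?_⟩
    exact main _ (star_mem hX)

end GroupVN

/-! ### Matrix norms on the predual and cb-norms -/

section PredualNorm

variable {H : Type u} [NormedAddCommGroup H] [InnerProductSpace ℂ H] [CompleteSpace H]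
  {M : VonNeumannAlgebra H}

omit [CompleteSpace H] in
theorem norm_sq_blockOp_apply {m : ℕ} (T : Matrix (Fin m) (Fin m) (H →L[ℂ] H))
    (α : PiLp 2 fun _ : Fin m => H) : ‖blockOp T α‖ ^ 2 = ∑ k, ‖∑ l, T k l (α l)‖ ^ 2 := by
  simp [PiLp.norm_sq_eq_of_L2, blockOp]

omit [CompleteSpace H] in
theorem blockOp_smul {m : ℕ} (c : ℂ) (T : Matrix (Fin m) (Fin m) (H →L[ℂ] H)) :
    blockOp (c • T) = c • blockOp T := by
  refine ContinuousLinearMap.ext fun α => ?_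
  ext k
  simp [blockOp, Finset.smul_sum]

theorem enorm_le_predualMatrixNorm {n m : ℕ} (φ : Matrix (Fin n) (Fin n) (predual M))
    (T : Matrix (Fin m) (Fin m) M.toStarSubalgebra)
    (hT : ‖blockOp (T.map fun t => (t : H →L[ℂ] H))‖ ≤ 1) :
    ‖Matrix.toEuclideanCLM (𝕜 := ℂ) (n := Fin n × Fin m)
      (Matrix.of fun p q => (φ p.1 q.1 : M.toStarSubalgebra →ₗ[ℂ] ℂ) (T p.2 q.2))‖ₑ ≤
      predualMatrixNorm M φ :=
  le_iSup_of_le m <| le_iSup_of_le T <| le_iSup_of_le hT le_rfl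

theorem predualMatrixNorm_add_le {n : ℕ} (φ ψ : Matrix (Fin n) (Fin n) (predual M)) :
    predualMatrixNorm M (φ + ψ) ≤ predualMatrixNorm M φ + predualMatrixNorm M ψ := by
  refine iSup_le fun m => iSup_le fun T => iSup_le fun hT => ?_
  refine le_trans ?_ (add_le_add (enorm_le_predualMatrixNorm φ T hT)
    (enorm_le_predualMatrixNorm ψ T hT))
  refine le_trans (le_of_eq ?_)
    ((ENNReal.coe_le_coe.2 (nnnorm_add_le _ _)).trans_eq (ENNReal.coe_add _ _))
  rw [← map_add]
  rfl

theorem predualMatrixNorm_smul_le {n : ℕ} (c : ℂ) (φ : Matrix (Fin n) (Fin n) (predual M)) :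
    predualMatrixNorm M (c • φ) ≤ ‖c‖ₑ * predualMatrixNorm M φ := by
  refine iSup_le fun m => iSup_le fun T => iSup_le fun hT => ?_
  refine le_trans ?_ (mul_le_mul_right (enorm_le_predualMatrixNorm φ T hT) _)
  rw [← enorm_smul, ← map_smul]
  rfl

theorem predualMatrixNorm_map_le {n : ℕ} {S : predual M →ₗ[ℂ] predual M}
    {φ : Matrix (Fin n) (Fin n) (predual M)} (h : predualMatrixNorm M φ ≤ 1) :
    predualMatrixNorm M (φ.map S) ≤ cbNorm M S :=
  le_iSup_of_le n <| le_iSup_of_le φ <| le_iSup_of_le h le_rfl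

theorem cbNorm_add_le (S S' : predual M →ₗ[ℂ] predual M) :
    cbNorm M (S + S') ≤ cbNorm M S + cbNorm M S' := by
  refine iSup_le fun n => iSup_le fun φ => iSup_le fun h => ?_
  exact (predualMatrixNorm_add_le (φ.map S) (φ.map S')).trans
    (add_le_add (predualMatrixNorm_map_le h) (predualMatrixNorm_map_le h))

/-- `cbNorm` only sees the unit ball, so `φ` is rescaled by `c⁻¹`. -/
theorem predualMatrixNorm_map_le_mul {n : ℕ} {S : predual M →ₗ[ℂ] predual M} {c : ℝ≥0}
    (hc : 0 < c) {φ : Matrix (Fin n) (Fin n) (predual M)} (h : predualMatrixNorm M φ ≤ c) :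
    predualMatrixNorm M (φ.map S) ≤ c * cbNorm M S := by
  have hc0 : ((c : ℝ) : ℂ) ≠ 0 := by exact_mod_cast hc.ne'
  have he : ‖((c : ℝ) : ℂ)‖ₑ = c := by simp [enorm]
  have h1 : predualMatrixNorm M (((c : ℝ) : ℂ)⁻¹ • φ) ≤ 1 := by
    refine (predualMatrixNorm_smul_le _ _).trans ?_
    rw [enorm_inv hc0, he]
    refine (mul_le_mul_right h _).trans ?_
    rw [ENNReal.inv_mul_cancel (by exact_mod_cast hc.ne') ENNReal.coe_ne_top]
  have h2 : φ.map S = ((c : ℝ) : ℂ) • (((c : ℝ) : ℂ)⁻¹ • φ).map S := by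
    ext1 i j
    simp [smul_smul, hc0]
  rw [h2]
  refine (predualMatrixNorm_smul_le _ _).trans ?_
  rw [he]
  exact mul_le_mul_right (predualMatrixNorm_map_le h1) _

theorem cbNorm_comp_le {S R : predual M →ₗ[ℂ] predual M} {c : ℝ≥0} (hc : 0 < c)
    (hR : cbNorm M R ≤ c) : cbNorm M (S ∘ₗ R) ≤ c * cbNorm M S := by
  refine iSup_le fun n => iSup_le fun φ => iSup_le fun h => ?_
  exact predualMatrixNorm_map_le_mul (φ := φ.map R) hc ((predualMatrixNorm_map_le h).trans hR)

/-- The preadjoint of a normal linear map `Φ` with completely bounded norm at most `c`. -/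
theorem cbNorm_le_of_preadjoint {S : predual M →ₗ[ℂ] predual M}
    {Φ : M.toStarSubalgebra →ₗ[ℂ] M.toStarSubalgebra} {c : ℝ≥0} (hc : 0 < c)
    (hS : ∀ φ T, (S φ : M.toStarSubalgebra →ₗ[ℂ] ℂ) T = (φ : M.toStarSubalgebra →ₗ[ℂ] ℂ) (Φ T))
    (hΦ : ∀ (m : ℕ) (T : Matrix (Fin m) (Fin m) M.toStarSubalgebra),
      ‖blockOp (T.map fun t => (Φ t : H →L[ℂ] H))‖ ≤
        c * ‖blockOp (T.map fun t => (t : H →L[ℂ] H))‖) :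
    cbNorm M S ≤ c := by
  have hc0 : ((c : ℝ) : ℂ) ≠ 0 := by exact_mod_cast hc.ne'
  have he : ‖((c : ℝ) : ℂ)‖ₑ = c := by simp [enorm]
  refine iSup_le fun n => iSup_le fun φ => iSup_le fun h => ?_
  refine iSup_le fun m => iSup_le fun T => iSup_le fun hT => ?_
  have h1 : ‖blockOp ((((c : ℝ) : ℂ)⁻¹ • T.map Φ).map fun t => (t : H →L[ℂ] H))‖ ≤ 1 := by
    have : ((((c : ℝ) : ℂ)⁻¹ • T.map Φ).map fun t => (t : H →L[ℂ] H)) =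
      ((c : ℝ) : ℂ)⁻¹ • T.map fun t => (Φ t : H →L[ℂ] H) := rfl
    rw [this, blockOp_smul, norm_smul, norm_inv, Complex.norm_real, NNReal.norm_eq]
    rw [inv_mul_le_iff₀ (by exact_mod_cast hc)]
    exact (hΦ m T).trans (mul_le_mul_of_nonneg_left hT c.2)
  have h2 := (enorm_le_predualMatrixNorm φ _ h1).trans h
  have h3 : (Matrix.of fun p q : Fin n × Fin m =>
      ((φ.map S) p.1 q.1 : M.toStarSubalgebra →ₗ[ℂ] ℂ) (T p.2 q.2)) = ((c : ℝ) : ℂ) •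
      Matrix.of fun p q : Fin n × Fin m => (φ p.1 q.1 : M.toStarSubalgebra →ₗ[ℂ] ℂ)
        ((((c : ℝ) : ℂ)⁻¹ • T.map Φ) p.2 q.2) := by
    ext p q
    simp [hS, hc0]
  rw [h3, map_smul, enorm_smul, he]
  exact (mul_le_mul_right h2 _).trans (by rw [mul_one])

theorem predualMatrixNorm_le_one_of_vectors {φ : predual M} {ξ η : H} (hξ : ‖ξ‖ = 1)
    (hη : ‖η‖ = 1)
    (h : ∀ T, (φ : M.toStarSubalgebra →ₗ[ℂ] ℂ) T = inner ℂ η ((T : H →L[ℂ] H) ξ)) :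
    predualMatrixNorm M (Matrix.of fun _ _ : Fin 1 => φ) ≤ 1 := by
  refine iSup_le fun m => iSup_le fun T => iSup_le fun hT => ?_
  rw [← ofReal_norm, ENNReal.ofReal_le_one]
  refine ContinuousLinearMap.opNorm_le_bound _ zero_le_one fun v => ?_
  rw [one_mul]
  -- The scalar matrix is a compression of the block operator: `v ↦ v ⊗ ξ` is isometric as `‖ξ‖ =
  -- 1`, and pairing each coordinate with the unit vector `η` is contractive.
  set w : PiLp 2 fun _ : Fin m => H := WithLp.toLp 2 fun l => v (0, l) • ξ with hw
  have h1 : ‖w‖ = ‖v‖ := by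
    rw [← sq_eq_sq₀ (norm_nonneg _) (norm_nonneg _), PiLp.norm_sq_eq_of_L2,
      EuclideanSpace.norm_sq_eq, Fintype.sum_prod_type]
    simp [hw, norm_smul, hξ]
  have h2 := (blockOp (T.map fun t => (t : H →L[ℂ] H))).le_of_opNorm_le hT w
  rw [one_mul, h1] at h2
  refine le_trans (le_of_sq_le_sq ?_ (norm_nonneg _)) h2
  rw [norm_sq_blockOp_apply, EuclideanSpace.norm_sq_eq, Fintype.sum_prod_type]
  simp only [Finset.univ_unique, Finset.sum_singleton]
  refine Finset.sum_le_sum fun k _ => ?_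
  gcongr
  have h3 := norm_inner_le_norm (𝕜 := ℂ) η
    (∑ l, (T.map fun t => (t : H →L[ℂ] H)) k l (w l))
  rw [hη, one_mul] at h3
  refine le_trans (le_of_eq ?_) h3
  congr 1
  simp [hw, Matrix.mulVec, dotProduct, Fintype.sum_prod_type, h, mul_comm, inner_sum,
    inner_smul_right]

end PredualNorm

/-! ### The multiplier norm and point masses -/

section MultNorm

variable {G : Type u} [Group G]

theorem multNorm_le_cbNorm {f : G → ℂ} {S : predual (groupVN G) →ₗ[ℂ] predual (groupVN G)}
    (h : IsMultiplication f S) : multNorm f ≤ cbNorm (groupVN G) S :=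
  iInf₂_le S h

theorem exists_of_multNorm_lt {f : G → ℂ} {a : ℝ≥0∞} (h : multNorm f < a) :
    ∃ S, IsMultiplication f S ∧ cbNorm (groupVN G) S < a := by
  simpa [multNorm, iInf_lt_iff] using h

theorem toFun_add (φ ψ : predual (groupVN G)) : toFun (φ + ψ) = toFun φ + toFun ψ := rfl

theorem toFun_smul (c : ℂ) (φ : predual (groupVN G)) : toFun (c • φ) = c • toFun φ := rfl

theorem IsMultiplication.apply {f : G → ℂ} {S : predual (groupVN G) →ₗ[ℂ] predual (groupVN G)}
    (h : IsMultiplication f S) (φ : predual (groupVN G)) (x : G) :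
    toFun (S φ) x = f x * toFun φ x :=
  congrFun (h φ) x

/-- Strict bounds on the infima supply actual operators, which can then be added. -/
theorem multNorm_add_lt {f g : G → ℂ} {a b : ℝ≥0∞} (hf : multNorm f < a) (hg : multNorm g < b) :
    multNorm (f + g) < a + b := by
  obtain ⟨S, hS, hSa⟩ := exists_of_multNorm_lt hf
  obtain ⟨R, hR, hRb⟩ := exists_of_multNorm_lt hg
  have : IsMultiplication (f + g) (S + R) := fun φ => funext fun x => by
    rw [LinearMap.add_apply, toFun_add, Pi.add_apply, hS.apply, hR.apply, Pi.mul_apply,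
      Pi.add_apply, add_mul]
  exact (multNorm_le_cbNorm this).trans_lt
    ((cbNorm_add_le S R).trans_lt (ENNReal.add_lt_add hSa hRb))

theorem multNorm_mul_le {f g : G → ℂ} {a b : ℝ≥0} (hf : multNorm f < a) (hg : multNorm g < b) :
    multNorm (f * g) ≤ a * b := by
  obtain ⟨S, hS, hSa⟩ := exists_of_multNorm_lt hf
  obtain ⟨R, hR, hRb⟩ := exists_of_multNorm_lt hg
  have : IsMultiplication (f * g) (S ∘ₗ R) := fun φ => funext fun x => by
    rw [LinearMap.comp_apply, hS.apply, hR.apply, Pi.mul_apply, Pi.mul_apply, mul_assoc]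
  have hb : 0 < b := by exact_mod_cast pos_of_gt hg
  refine (multNorm_le_cbNorm this).trans ((cbNorm_comp_le hb hRb.le).trans ?_)
  rw [mul_comm]
  exact mul_le_mul_left hSa.le _

variable [DecidableEq G]

/-- The functional `T ↦ ⟨T δ₁, δₓ⟩`, which corresponds to the function `δₓ` on `G`. -/
def pointFunctional (x : G) : predual (groupVN G) :=
  ⟨{ toFun := fun T => (T : ell2 G →L[ℂ] ell2 G) (lp.single 2 1 (1 : ℂ)) x
     map_add' := fun S T => rfl
     map_smul' := fun c T => rfl },
    isNormal_of_hasSum (ι := Unit) _ _ (fun _ => lp.single 2 1 (1 : ℂ))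
      (fun _ => lp.single 2 x (1 : ℂ)) (Summable.of_finite) (Summable.of_finite) fun T => by
        convert hasSum_fintype (fun _ : Unit => inner ℂ (lp.single 2 x (1 : ℂ) : ell2 G)
          ((T : ell2 G →L[ℂ] ell2 G) (lp.single 2 1 (1 : ℂ)))) using 1
        simp only [lp.inner_single_left]
        simp
        rfl⟩

theorem pointFunctional_apply (x : G) (T : (groupVN G).toStarSubalgebra) :
    (pointFunctional x : (groupVN G).toStarSubalgebra →ₗ[ℂ] ℂ) T =
      (T : ell2 G →L[ℂ] ell2 G) (lp.single 2 1 (1 : ℂ)) x := rfl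

theorem toFun_pointFunctional (x : G) : toFun (pointFunctional x) = Pi.single x (1 : ℂ) := by
  ext y
  rw [toFun, pointFunctional_apply]
  change leftReg y _ x = _
  rw [leftReg_single, mul_one]
  simp [Pi.single_apply, eq_comm]

theorem predualMatrixNorm_pointFunctional_le (x : G) :
    predualMatrixNorm (groupVN G) (Matrix.of fun _ _ : Fin 1 => pointFunctional x) ≤ 1 :=
  predualMatrixNorm_le_one_of_vectors (ξ := lp.single 2 1 (1 : ℂ)) (η := lp.single 2 x (1 : ℂ))
    (by simp [lp.norm_single]) (by simp [lp.norm_single]) fun T => by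
      rw [lp.inner_single_left, pointFunctional_apply]
      simp

omit [DecidableEq G] in
theorem norm_leftReg_apply (x : G) (ξ : ell2 G) : ‖leftReg x ξ‖ ≤ ‖ξ‖ := by
  simpa using (leftReg x).le_of_opNorm_le (LinearMap.mkContinuous_norm_le _ zero_le_one _) ξ

/-- The image under `M_f` of the point mass at `x`, which has norm at most one, is paired with the
contraction `λ(x)`; the value is `f x`. -/
theorem enorm_apply_le_multNorm (f : G → ℂ) (x : G) : ‖f x‖ₑ ≤ multNorm f := by
  refine le_iInf₂ fun S hS => ?_
  refine le_trans ?_ (predualMatrixNorm_map_le (predualMatrixNorm_pointFunctional_le x))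
  have hT : ‖blockOp ((Matrix.of fun _ _ : Fin 1 => lambda x).map
      fun t => (t : ell2 G →L[ℂ] ell2 G))‖ ≤ 1 := by
    refine ContinuousLinearMap.opNorm_le_bound _ zero_le_one fun α => ?_
    rw [one_mul]
    refine le_of_sq_le_sq ?_ (norm_nonneg _)
    rw [norm_sq_blockOp_apply, PiLp.norm_sq_eq_of_L2]
    simp only [Finset.univ_unique, Finset.sum_singleton]
    gcongr
    exact norm_leftReg_apply x _
  refine le_trans (le_of_eq ?_) (enorm_le_predualMatrixNorm _ _ hT)
  have h1 : (S (pointFunctional x) : (groupVN G).toStarSubalgebra →ₗ[ℂ] ℂ) (lambda x) = f x := by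
    have := congrFun (hS (pointFunctional x)) x
    rw [toFun_pointFunctional] at this
    rw [Pi.mul_apply, Pi.single_eq_same, mul_one] at this
    exact this
  have h2 : (Matrix.of fun p q : Fin 1 × Fin 1 =>
      (((Matrix.of fun _ _ : Fin 1 => pointFunctional x).map S) p.1 q.1 :
        (groupVN G).toStarSubalgebra →ₗ[ℂ] ℂ) ((Matrix.of fun _ _ : Fin 1 => lambda x) p.2 q.2)) =
      f x • (1 : Matrix (Fin 1 × Fin 1) (Fin 1 × Fin 1) ℂ) := by
    ext p q
    rw [Subsingleton.elim q p]
    simp [h1]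
  rw [h2, map_smul, map_one, enorm_smul, enorm_one, mul_one]

omit [DecidableEq G] in
theorem mem_fourierAlgebra_of_finite_support {f : G → ℂ} (hf : (Function.support f).Finite) :
    f ∈ fourierAlgebra G := by
  classical
  refine ⟨∑ x ∈ hf.toFinset, f x • pointFunctional x, ?_⟩
  let L : predual (groupVN G) →ₗ[ℂ] G → ℂ :=
    { toFun := toFun, map_add' := toFun_add, map_smul' := toFun_smul }
  have hL (x : G) : L (pointFunctional x) = Pi.single x (1 : ℂ) := toFun_pointFunctional x
  change L _ = f
  simp only [map_sum, map_smul, hL]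
  ext y
  by_cases h : f y = 0 <;> simp [Finset.sum_apply, Pi.single_apply, h]

end MultNorm

/-! ### From Schur multipliers to multipliers of `A(G)` -/

section Schur

variable {G : Type u} [Group G] {ι : Type v}

/-- `b` and `a` factor the kernel `(s, t) ↦ k (s t⁻¹)`. -/
def Column.Represents (b a : Column ι G) (k : G → ℂ) : Prop :=
  ∀ s t, HasSum (fun i => starRingEnd ℂ (b.coord i s) * a.coord i t) (k (s * t⁻¹))

namespace Column

variable {b a : Column ι G} {k : G → ℂ}

theorem Represents.schurOp_single [DecidableEq G] (h : b.Represents a k)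
    (T : ell2 G →L[ℂ] ell2 G) (s t : G) :
    schurOp b a T (lp.single 2 t (1 : ℂ)) s = k (s * t⁻¹) * T (lp.single 2 t (1 : ℂ)) s :=
  (hasSum_inner_schurOp_single b a T s t).unique ((h s t).mul_right _)

/-- The kernel `k (s * t⁻¹)` is invariant under `(s, t) ↦ (s * r, t * r)`, so right invariance of
the matrix survives. -/
theorem Represents.schurOp_mem (h : b.Represents a k) {T : ell2 G →L[ℂ] ell2 G}
    (hT : T ∈ (groupVN G).toStarSubalgebra) : schurOp b a T ∈ (groupVN G).toStarSubalgebra := by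
  classical
  rw [mem_groupVN_iff] at hT ⊢
  intro s t r
  rw [h.schurOp_single, h.schurOp_single, hT]
  group

/-- Schur multiplication on the group von Neumann algebra. -/
def Represents.schurVN (h : b.Represents a k) :
    (groupVN G).toStarSubalgebra →ₗ[ℂ] (groupVN G).toStarSubalgebra where
  toFun T := ⟨schurOp b a T, h.schurOp_mem T.2⟩
  map_add' S T := Subtype.ext (schurOp_add b a S T)
  map_smul' c T := Subtype.ext (schurOp_smul b a c T)

theorem Represents.coe_schurVN (h : b.Represents a k) (T : (groupVN G).toStarSubalgebra) :
    (h.schurVN T : ell2 G →L[ℂ] ell2 G) = schurOp b a T := rfl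

/-- The matrix of `λ(x)` lives on `s * t⁻¹ = x`, where the kernel is constantly `k x`. -/
theorem Represents.schurVN_lambda (h : b.Represents a k) (x : G) :
    h.schurVN (lambda x) = k x • lambda x := by
  classical
  refine Subtype.ext (ext_single fun s t => ?_)
  rw [h.coe_schurVN, h.schurOp_single]
  change k (s * t⁻¹) * leftReg x (lp.single 2 t (1 : ℂ)) s =
    k x * leftReg x (lp.single 2 t (1 : ℂ)) s
  rw [leftReg_single]
  by_cases hs : s = x * t
  · rw [hs, mul_inv_cancel_right]
  · simp [hs]

/-- Replacing `ξ n`, `η n` by all `Dᵢ(a) ξ n`, `Dᵢ(b) η n` keeps square summability, now over `ℕ ×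
ι`. The composite therefore has a preadjoint on `VN(G)_*`. -/
theorem Represents.isNormal_comp_schurVN (h : b.Represents a k)
    {φ : (groupVN G).toStarSubalgebra →ₗ[ℂ] ℂ} (hφ : IsNormal (groupVN G) φ) :
    IsNormal (groupVN G) (φ ∘ₗ h.schurVN) := by
  obtain ⟨ξ, η, hξ, hη, hsum⟩ := hφ
  have key (c : Column ι G) (ζ : ℕ → ell2 G) (hζ : Summable fun n => ‖ζ n‖ ^ 2) :
      Summable fun p : ℕ × ι => ‖c.diag p.2 (ζ p.1)‖ ^ 2 := by
    rw [summable_prod_of_nonneg fun p => sq_nonneg _]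
    refine ⟨fun n => (c.hasSum_norm_diag_sq (ζ n)).summable, ?_⟩
    simp only [(c.hasSum_norm_diag_sq _).tsum_eq, mul_pow]
    exact hζ.mul_left _
  have hb := key b η hη
  have ha := key a ξ hξ
  refine isNormal_of_hasSum (ι := ℕ × ι) _ _ (fun p => a.diag p.2 (ξ p.1))
    (fun p => b.diag p.2 (η p.1)) ha hb fun T => ?_
  have hs : Summable fun p : ℕ × ι => inner ℂ (b.diag p.2 (η p.1))
      ((T : ell2 G →L[ℂ] ell2 G) (a.diag p.2 (ξ p.1))) := by
    refine Summable.of_norm_bounded ((hb.add ha).mul_left ‖(T : ell2 G →L[ℂ] ell2 G)‖) fun p => ?_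
    refine (norm_inner_le_norm _ _).trans ?_
    have h1 := (T : ell2 G →L[ℂ] ell2 G).le_opNorm (a.diag p.2 (ξ p.1))
    have h2 := two_mul_le_add_sq ‖b.diag p.2 (η p.1)‖ ‖a.diag p.2 (ξ p.1)‖
    calc _ ≤ ‖b.diag p.2 (η p.1)‖ * (‖(T : ell2 G →L[ℂ] ell2 G)‖ * ‖a.diag p.2 (ξ p.1)‖) := by
          gcongr
      _ = ‖(T : ell2 G →L[ℂ] ell2 G)‖ * (‖b.diag p.2 (η p.1)‖ * ‖a.diag p.2 (ξ p.1)‖) := by ring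
      _ ≤ _ := by
          gcongr
          have := mul_nonneg (_root_.norm_nonneg (b.diag p.2 (η p.1)))
            (_root_.norm_nonneg (a.diag p.2 (ξ p.1)))
          linarith
  convert hs.hasSum using 1
  refine (hsum (h.schurVN T)).unique ?_
  exact hs.hasSum.prod_fiberwise fun n => b.hasSum_inner_schurOp a T (η n) (ξ n)

/-- Schur multiplication on the predual. -/
def Represents.predualMap (h : b.Represents a k) :
    predual (groupVN G) →ₗ[ℂ] predual (groupVN G) where
  toFun φ := ⟨φ.1 ∘ₗ h.schurVN, h.isNormal_comp_schurVN φ.2⟩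
  map_add' _ _ := rfl
  map_smul' _ _ := rfl

theorem Represents.isMultiplication (h : b.Represents a k) :
    IsMultiplication k h.predualMap := fun φ => funext fun x => by
  change φ.1 (h.schurVN (lambda x)) = k x * φ.1 (lambda x)
  rw [h.schurVN_lambda, map_smul, smul_eq_mul]

/-- This is the sufficiency half of Gilbert's criterion for cb-multipliers: `M_k` is the preadjoint
of a Schur multiplication. -/
theorem Represents.multNorm_le (h : b.Represents a k) {c : ℝ≥0} (hc : 0 < c)
    (hba : b.norm * a.norm ≤ c) : multNorm k ≤ c := by
  refine (multNorm_le_cbNorm h.isMultiplication).trans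
    (cbNorm_le_of_preadjoint (Φ := h.schurVN) hc (fun φ T => rfl) fun m T => ?_)
  refine (b.norm_blockOp_schurOp_le a (T.map fun t => (t : ell2 G →L[ℂ] ell2 G))).trans ?_
  gcongr

end Column

end Schur

/-! ### Coefficients of multiples of the regular representation -/

section Coefficient

variable {G : Type u} [Group G] {J : Type u}

/-- The column with values the right translates of `ξ`. -/
def translates (ξ : ell2 (J × G)) : Column (J × G) G where
  coord p t := ξ (p.1, t * p.2)
  norm := ‖ξ‖
  norm_nonneg := norm_nonneg _
  hasSum t := ((Equiv.prodCongrRight fun _ : J => Equiv.mulLeft t).hasSum_iff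
    (f := fun p => ‖ξ p‖ ^ 2)).2 (hasSum_norm_sq ξ)

/-- The coefficient function `x ↦ ⟨(1 ⊗ λ(x)) ξ, η⟩`. -/
def coefficient (η ξ : ell2 (J × G)) (x : G) : ℂ :=
  ∑' p : J × G, starRingEnd ℂ (η p) * ξ (p.1, x⁻¹ * p.2)

theorem hasSum_coefficient (η ξ : ell2 (J × G)) (x : G) :
    HasSum (fun p : J × G => starRingEnd ℂ (η p) * ξ (p.1, x⁻¹ * p.2)) (coefficient η ξ x) := by
  refine (summable_norm_and_norm_tsum_le (fun p => norm_nonneg (η p)) (fun p => norm_nonneg _)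
    (norm_nonneg η) (norm_nonneg ξ) zero_le_one (hasSum_norm_sq η)
    ((translates ξ).hasSum x⁻¹) fun p => ?_).1.of_norm.hasSum
  simp [translates]

/-- By unitarity, `⟨λ(s t⁻¹) ξ, η⟩ = ⟨λ(t⁻¹) ξ, λ(s⁻¹) η⟩`; concretely, the summation variable in
`G` is shifted by `s`. -/
theorem represents_coefficient (η ξ : ell2 (J × G)) :
    (translates η).Represents (translates ξ) (coefficient η ξ) := fun s t => by
  have := ((Equiv.prodCongrRight fun _ : J => Equiv.mulLeft s).hasSum_iff).2
    (hasSum_coefficient η ξ (s * t⁻¹))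
  convert this using 2 with p
  change _ = starRingEnd ℂ (η (p.1, s * p.2)) * ξ (p.1, (s * t⁻¹)⁻¹ * (s * p.2))
  simp [translates, mul_assoc]

theorem multNorm_coefficient_le {η ξ : ell2 (J × G)} {c : ℝ≥0} (hc : 0 < c)
    (h : ‖η‖ * ‖ξ‖ ≤ c) : multNorm (coefficient η ξ) ≤ c :=
  (represents_coefficient η ξ).multNorm_le hc h

theorem coefficient_sub_right (η ξ ξ' : ell2 (J × G)) :
    coefficient η (ξ - ξ') = coefficient η ξ - coefficient η ξ' := funext fun x => by
  refine (hasSum_coefficient η (ξ - ξ') x).unique ?_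
  simpa [mul_sub] using (hasSum_coefficient η ξ x).sub (hasSum_coefficient η ξ' x)

theorem coefficient_sub_left (η η' ξ : ell2 (J × G)) :
    coefficient (η - η') ξ = coefficient η ξ - coefficient η' ξ := funext fun x => by
  refine (hasSum_coefficient (η - η') ξ x).unique ?_
  simpa [sub_mul] using (hasSum_coefficient η ξ x).sub (hasSum_coefficient η' ξ x)

/-- A nonzero term at `x` writes `x` as `g * h⁻¹` with `g`, `h` the `G`-coordinates of points in the
two supports. -/
theorem finite_support_coefficient {η ξ : ell2 (J × G)} (hη : (Function.support η).Finite)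
    (hξ : (Function.support ξ).Finite) : (Function.support (coefficient η ξ)).Finite := by
  refine ((hη.prod hξ).image fun q => q.1.2 * q.2.2⁻¹).subset fun x hx => ?_
  obtain ⟨p, hp⟩ : ∃ p : J × G, starRingEnd ℂ (η p) * ξ (p.1, x⁻¹ * p.2) ≠ 0 := by
    by_contra! h0
    exact hx (by simp [coefficient, h0])
  refine ⟨(p, (p.1, x⁻¹ * p.2)), ⟨?_, ?_⟩, by simp⟩
  · exact fun h => hp (by simp [h])
  · exact fun h => hp (by simp [h])

theorem exists_finite_support_norm_sub_lt {I : Type u} (ξ : ell2 I) {ε : ℝ} (hε : 0 < ε) :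
    ∃ ξ' : ell2 I, (Function.support ξ').Finite ∧ ‖ξ - ξ'‖ < ε := by
  classical
  obtain ⟨s, hs⟩ := (Metric.tendsto_atTop.1 (lp.hasSum_single (p := 2) (by norm_num) ξ) ε hε)
  refine ⟨∑ i ∈ s, lp.single 2 i (ξ i), s.finite_toSet.subset fun j hj => ?_, ?_⟩
  · by_contra h
    apply hj
    rw [lp.coeFn_sum, Finset.sum_apply]
    exact Finset.sum_eq_zero fun i hi => lp.single_apply_ne _ _ _ fun hji => h (hji ▸ hi)
  · rw [norm_sub_rev, ← dist_eq_norm]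
    exact hs s le_rfl

/-- Finitely supported functions are dense among the coefficients, in the multiplier norm. -/
theorem exists_finite_support_multNorm_coefficient_sub_lt (η ξ : ell2 (J × G)) {ε : ℝ≥0}
    (hε : 0 < ε) :
    ∃ v : G → ℂ, (Function.support v).Finite ∧ multNorm (coefficient η ξ - v) < ε := by
  -- Dividing by `N + 1` covers `N = 0`. Each truncation costs at most `ε / 4`, hence strictly less
  -- than `ε / 2`. The tolerance for `η` is chosen after `ξ'`, since it depends on `‖ξ'‖`.
  have key : ∀ N : ℝ, 0 ≤ N → ∃ δ : ℝ, 0 < δ ∧ N * δ ≤ ε / 4 := fun N hN =>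
    ⟨ε / 4 / (N + 1), by positivity, by
      rw [mul_div_assoc', div_le_iff₀ (by positivity)]
      nlinarith [show (0 : ℝ) < ε from hε]⟩
  obtain ⟨δ, hδ, hδ'⟩ := key ‖η‖ (norm_nonneg _)
  obtain ⟨ξ', hξ', hd⟩ := exists_finite_support_norm_sub_lt ξ hδ
  obtain ⟨γ, hγ, hγ'⟩ := key ‖ξ'‖ (norm_nonneg _)
  obtain ⟨η', hη', he⟩ := exists_finite_support_norm_sub_lt η hγ
  refine ⟨coefficient η' ξ', finite_support_coefficient hη' hξ', ?_⟩
  have h4 : (0 : ℝ≥0) < ε / 4 := by positivity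
  have hlt : ((ε / 4 : ℝ≥0) : ℝ≥0∞) < ((ε / 2 : ℝ≥0) : ℝ≥0∞) := by
    rw [ENNReal.coe_lt_coe]
    exact div_lt_div_of_pos_left hε (by norm_num) (by norm_num)
  have h1 : multNorm (coefficient η (ξ - ξ')) < ((ε / 2 : ℝ≥0) : ℝ≥0∞) := by
    refine (multNorm_coefficient_le h4 ?_).trans_lt hlt
    refine le_trans ?_ (hδ'.trans_eq (by simp))
    gcongr
  have h2 : multNorm (coefficient (η - η') ξ') < ((ε / 2 : ℝ≥0) : ℝ≥0∞) := by
    refine (multNorm_coefficient_le h4 ?_).trans_lt hlt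
    refine le_trans ?_ (hγ'.trans_eq (by simp))
    rw [mul_comm]
    gcongr
  have := multNorm_add_lt h1 h2
  rw [coefficient_sub_right, coefficient_sub_left, sub_add_sub_cancel, ← ENNReal.coe_add,
    add_halves] at this
  exact this

/-- The sequences of vectors that witness normality assemble into two single vectors of `ℓ²(ℕ × G)`.
-/
theorem exists_eq_coefficient {u : G → ℂ} (hu : u ∈ fourierAlgebra G) :
    ∃ η ξ : ell2 (ULift.{u} ℕ × G), u = coefficient η ξ := by
  obtain ⟨φ, rfl⟩ := hu
  obtain ⟨ξ, η, hξ, hη, hsum⟩ := φ.2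
  have key (ζ : ℕ → ell2 G) (hζ : Summable fun n => ‖ζ n‖ ^ 2) :
      Memℓp (fun p : ULift.{u} ℕ × G => ζ p.1.down p.2) 2 := by
    refine memℓp_two_of_summable ?_
    rw [summable_prod_of_nonneg fun p => sq_nonneg _]
    refine ⟨fun n => (hasSum_norm_sq (ζ n.down)).summable, ?_⟩
    simp only [(hasSum_norm_sq _).tsum_eq]
    exact hζ.comp_injective ULift.down_injective
  refine ⟨⟨_, key η hη⟩, ⟨_, key ξ hξ⟩, funext fun x => ?_⟩
  refine (Equiv.ulift.hasSum_iff.2 (hsum (lambda x))).unique ?_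
  refine (hasSum_coefficient (J := ULift.{u} ℕ) ⟨_, key η hη⟩ ⟨_, key ξ hξ⟩ x).prod_fiberwise
    fun n => ?_
  have := lp.hasSum_inner (𝕜 := ℂ) (η n.down) (leftReg x (ξ n.down))
  simp only [RCLike.inner_apply', leftReg_apply] at this
  exact this

end Coefficient

/-! ### Spectral synthesis -/

section Synthesis

variable {G : Type u} [Group G]

theorem eq_zero_of_mem_Jcb {F : Set G} {f : G → ℂ} (hf : f ∈ Jcb F) {x : G} (hx : x ∈ F) :
    f x = 0 := by
  classical
  by_contra h
  -- An approximant vanishing at `x` cannot be closer to `f` than `|f x|`.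
  obtain ⟨g, ⟨-, -, hg⟩, hlt⟩ := hf.2 ‖f x‖ₑ (by simpa using h)
  have hgx : g x = 0 := by
    by_contra h0
    exact Set.disjoint_left.1 hg h0 hx
  refine absurd ((enorm_apply_le_multNorm (f - g) x).trans_lt hlt) ?_
  simp [hgx]

theorem Jcb_subset_Icb (F : Set G) : Jcb F ⊆ Icb F := fun _ hf =>
  ⟨⟨hf.1, fun ε hε => (hf.2 ε hε).imp fun _ h => ⟨h.1.1, h.2⟩⟩, fun _ => eq_zero_of_mem_Jcb hf⟩

theorem exists_finite_support_multNorm_sub_lt {f : G → ℂ} (hf : f ∈ Acb G) {ε : ℝ≥0}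
    (hε : 0 < ε) : ∃ v : G → ℂ, (Function.support v).Finite ∧ multNorm (f - v) < ε := by
  have h2 : 0 < ε / 2 := by positivity
  obtain ⟨w, hw, hfw⟩ := hf.2 (ε / 2 : ℝ≥0) (by exact_mod_cast h2)
  obtain ⟨η, ξ, rfl⟩ := exists_eq_coefficient hw
  obtain ⟨v, hv, hwv⟩ := exists_finite_support_multNorm_coefficient_sub_lt η ξ h2
  refine ⟨v, hv, ?_⟩
  have := multNorm_add_lt hfw hwv
  rwa [sub_add_sub_cancel, ← ENNReal.coe_add, add_halves] at this

/-- This reconciles `f * e - f` in the approximate identity with `f - g` in the closure. -/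
theorem multNorm_neg_le (f : G → ℂ) : multNorm (-f) ≤ multNorm f := by
  refine le_iInf₂ fun S hS => ?_
  have hneg : IsMultiplication (-f) ((-1 : ℂ) • S) := fun φ => funext fun x => by
    rw [LinearMap.smul_apply, toFun_smul, Pi.smul_apply, hS.apply, Pi.mul_apply, Pi.neg_apply,
      smul_eq_mul, neg_one_mul, neg_mul]
  refine (multNorm_le_cbNorm hneg).trans ?_
  refine iSup_le fun n => iSup_le fun φ => iSup_le fun h => ?_
  refine (predualMatrixNorm_smul_le (-1 : ℂ) (φ.map S)).trans ?_
  rw [enorm_neg, enorm_one, one_mul]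
  exact predualMatrixNorm_map_le h

/-- The estimate rests on `f - f * v = (f - f * e) + f * (e - v)`, with `e` from the approximate
identity and `v` finitely supported. Multiplying by `f` forces the approximant to vanish on `F`. -/
theorem Icb_subset_Jcb (hG : IsWeaklyAmenable G) (F : Set G) : Icb F ⊆ Jcb F := by
  rintro f ⟨hf, hF⟩
  refine ⟨hf.1, fun ε hε => ?_⟩
  obtain ⟨δ, hδ, hδε⟩ : ∃ δ : ℝ≥0, 0 < δ ∧ (δ : ℝ≥0∞) < ε := by
    obtain ⟨δ, h1, h2⟩ := ENNReal.lt_iff_exists_nnreal_btwn.1 hε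
    exact ⟨δ, by exact_mod_cast h1, h2⟩
  obtain ⟨C, hC, -⟩ := ENNReal.lt_iff_exists_nnreal_btwn.1 hf.1
  have hCpos : 0 < C := by exact_mod_cast pos_of_gt hC
  obtain ⟨ι, _, _, _, e, C', he, hlim⟩ := hG
  have h2 : 0 < δ / 2 := by positivity
  obtain ⟨i, hi⟩ := ((hlim f hf).eventually_lt_const
    (show (0 : ℝ≥0∞) < (δ / 2 : ℝ≥0) by exact_mod_cast h2)).exists
  -- Since `C` exceeds the multiplier norm of `f`, the product `f * (e i - v)` costs at most `δ /
  -- 3`, strictly below the allotted `δ / 2`.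
  obtain ⟨v, hv, hev⟩ := exists_finite_support_multNorm_sub_lt (he i).1
    (show 0 < δ / 3 / C by positivity)
  have hsupp : Function.support (f * v) ⊆ Function.support v := fun x hx h => hx (by simp [h])
  have hfin := hv.subset hsupp
  refine ⟨f * v, ⟨mem_fourierAlgebra_of_finite_support hfin, hfin, ?_⟩, ?_⟩
  · exact Set.disjoint_left.2 fun x hx hxF => hx (by simp [hF x hxF])
  · have h1 := (multNorm_neg_le _).trans_lt hi
    have h3 : multNorm (f * (e i - v)) < ((δ / 2 : ℝ≥0) : ℝ≥0∞) := by
      refine (multNorm_mul_le hC hev).trans_lt ?_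
      rw [← ENNReal.coe_mul, mul_div_cancel₀ _ hCpos.ne', ENNReal.coe_lt_coe]
      exact div_lt_div_of_pos_left hδ (by norm_num) (by norm_num)
    have h := multNorm_add_lt h1 h3
    rw [← ENNReal.coe_add, add_halves, show -(f * e i - f) + f * (e i - v) = f - f * v by ring] at h
    exact h.trans hδε

end Synthesis

end FourierCB

end

theorem mainTheorem9 {G : Type*} [Group G] (hG : FourierCB.IsWeaklyAmenable G) (F : Set G) :
    FourierCB.IsSynthesisSet F :=
  (FourierCB.Jcb_subset_Icb F).antisymm (FourierCB.Icb_subset_Jcb hG F)
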